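/- Let $d\ge 0$ be an integer and let $A=\{0,v_1,\dots,v_{d+1},w\}\subset\mathbb Z^d$ be a set of exactly $d+3$ elements whose convex hull in $\mathbb R^d$ is a (nondegenerate) simplex with vertices $v_1,\dots,v_{d+1}$, and assume that $v_1,\dots,v_{d+1}$ generate $\mathbb Z^d$ as an abelian group. For $h\in\mathbb Z_{\ge 0}$ let $hA=\{x_1+\dots+x_h : x_i\in A\}$ (so $0A=\{0\}$), and for $x\in\mathbb Z^d$ write $\tilde x=(x,1)\in\mathbb Z^{d+1}$. Write $$(0,1)=\frac{a_1}{q_1}\tilde v_1+\dots+\frac{a_{d+1}}{q_{d+1}}\tilde v_{d+1},$$ where $a_i\ge 0$ and $q_i\ge 1$ are integers with $\gcd(a_i,q_i)=1$; then $\sum_i a_i/q_i=1$. Let $\Lambda$ be the subgroup of $\mathbb Z^{d+1}$ generated by $\tilde v_1,\dots,\tilde v_{d+1}$. Let $\Lambda_{(0,1)}$ be the subgroup, and $\Lambda_{(0,1)}^+$ the submonoid, of $\mathbb Z^{d+1}$ generated by $(0,1),\tilde v_1,\dots,\tilde v_{d+1}$. Let $N=[\mathbb Z^{d+1}:\Lambda]$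 and $N_0=[\mathbb Z^{d+1}:\Lambda_{(0,1)}]$. For integers $1\le K\le N$ and $h\ge 0$ put $$F_K(h)=\begin{cases}\displaystyle\sum_{m=0}^{h}\binom{m+d+1}{m}, & h\le K-1,\\[2mm] \displaystyle\sum_{m=0}^{K-1}\binom{h+d+1-m}{h-m}, & K\le h\le N-1,\\[2mm] \displaystyle\sum_{m=0}^{K-1}\binom{h+d+1-m}{h-m}-\sum_{m=0}^{h-N}\binom{m+d+1}{m}, & N\le h\le N+K-1,\\[2mm] \displaystyle\sum_{m=0}^{K-1}\binom{h+d+1-m}{h-m}-\sum_{m=0}^{K-1}\binom{h+d+1-m-N}{h-m-N}, & h\ge N+K.\end{cases}$$ Then the following hold. 1. $N_0=N/\operatorname{lcm}(q_1,\dots,q_{d+1})$. 2. If $N_0\tilde w\in\Lambda_{(0,1)}^+$, then $|hA|=F_{N_0}(h)$ for all $h\ge 0$. 3. In general, there is a smallest positive integer $M_w$ with $M_wN_0\tilde w\in\Lambda_{(0,1)}^+$; it satisfies $M_wN_0\le N$, and $F_{N_0}(h)\le |hA|\le F_{M_wN_0}(h)$ for all $h\ge 0$. 4. For $0\le h\le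 N_0-1$ one has $|hA|=\sum_{m=0}^{h}\binom{m+d+1}{m}$. -/

import Mathlib

namespace SimplexSumset

/-- The `h`-fold sumset `hA = {a₁ + ⋯ + a_h : a_i ∈ A}` of `A ⊆ ℤ^d`. -/
def sumset {d : ℕ} (h : ℕ) (A : Set (Fin d → ℤ)) : Set (Fin d → ℤ) :=
  {x | ∃ a : Fin h → (Fin d → ℤ), (∀ i, a i ∈ A) ∧ x = ∑ i, a i}

/-- The inclusion `ℤ^d ⊆ ℝ^d`. -/
def toReal {d : ℕ} (x : Fin d → ℤ) : Fin d → ℝ := fun j => (x j : ℝ)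

/-- The convex hull `Δ_A ⊆ ℝ^d` of `A ⊆ ℤ^d`. -/
def hull {d : ℕ} (A : Set (Fin d → ℤ)) : Set (Fin d → ℝ) :=
  convexHull ℝ (toReal '' A)

/-- The convex hull of `A` is a (nondegenerate) simplex whose vertices are `v₁, …, v_{d+1}`. -/
def HullIsSimplex {d : ℕ} (A : Set (Fin d → ℤ)) (v : Fin (d + 1) → (Fin d → ℤ)) : Prop :=
  AffineIndependent ℝ (fun i => toReal (v i)) ∧ hull A = hull (Set.range v)

/-- The lift `(x, 1)` of `x` to `ℤ^(d+1) = ℤ^d × ℤ`. -/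
def lift {d : ℕ} (x : Fin d → ℤ) : (Fin d → ℤ) × ℤ := (x, 1)

/-- The lattice `Λ` spanned over `ℤ` by the lifts of the `v_i`. -/
def lattice {d : ℕ} (v : Fin (d + 1) → (Fin d → ℤ)) : AddSubgroup ((Fin d → ℤ) × ℤ) :=
  AddSubgroup.closure (Set.range fun i => lift (v i))

/-- The lattice `Λ_{(0,1)}` spanned over `ℤ` by `(0,1)` and the lifts of the `v_i`. -/
def latticeZero {d : ℕ} (v : Fin (d + 1) → (Fin d → ℤ)) : AddSubgroup ((Fin d → ℤ) × ℤ) :=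
  AddSubgroup.closure (insert (lift 0) (Set.range fun i => lift (v i)))

/-- The cone `Λ_{(0,1)}⁺` spanned over `ℕ` by `(0,1)` and the lifts of the `v_i`. -/
def coneZero {d : ℕ} (v : Fin (d + 1) → (Fin d → ℤ)) : AddSubmonoid ((Fin d → ℤ) × ℤ) :=
  AddSubmonoid.closure (insert (lift 0) (Set.range fun i => lift (v i)))

/-- The index of `Λ` in `ℤ^(d+1)`. -/
noncomputable def latticeIndex {d : ℕ} (v : Fin (d + 1) → (Fin d → ℤ)) : ℕ :=
  (lattice v).index

/-- The index of `Λ_{(0,1)}` in `ℤ^(d+1)`. -/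
noncomputable def latticeZeroIndex {d : ℕ} (v : Fin (d + 1) → (Fin d → ℤ)) : ℕ :=
  (latticeZero v).index

/-- The piecewise expression in `h`, with thresholds `K`, `N` and `N + K` (where `1 ≤ K ≤ N`).
In each branch every natural-number subtraction that occurs is a genuine one. -/
def piecewiseSum (d N K h : ℕ) : ℤ :=
  if h < K then
    ∑ m ∈ Finset.range (h + 1), ((m + d + 1).choose m : ℤ)
  else if h < N then
    ∑ m ∈ Finset.range K, ((h + d + 1 - m).choose (h - m) : ℤ)
  else if h < N + K then
    ∑ m ∈ Finset.range K, ((h + d + 1 - m).choose (h - m) : ℤ)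
      - ∑ m ∈ Finset.range (h - N + 1), ((m + d + 1).choose m : ℤ)
  else
    ∑ m ∈ Finset.range K, ((h + d + 1 - m).choose (h - m) : ℤ)
      - ∑ m ∈ Finset.range K, ((h + d + 1 - m - N).choose (h - m - N) : ℤ)

end SimplexSumset

/-!
Lifting to height one turns `hA` into the slice at height `h` of the monoid generated by `(0, 1)`,
`(w, 1)` and the `(v i, 1)`. Thus an element of `hA` is given by multiplicities `m` of `w`, `j` of
`0` and `k i` of `v i` with total `h`, and the task is to choose normal forms.

Since the `v i` are affinely independent, the vectors `(v i, 1)` are linearly independent, and the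
multiple `n • (0, 1)` lies in `Λ` exactly when every `q i` divides `n`
(`nsmul_lift_zero_mem_lattice_iff`). So `L = lcm q` is the order of `(0, 1)` modulo `Λ`. The
differences `(v i, 1) - (0, 1)` generate `ℤ^d × 0` because the `v i` generate `ℤ^d`; hence
`Λ_{(0,1)}` is all of `ℤ^(d+1)`, its index is `1`, and the index `N` of `Λ` is `L`
(`latticeZero_eq_top`, `latticeIndex_eq_lcm`).

Upper bound: `N • (0, 1)` is a nonnegative integer combination of the `(v i, 1)`, and
`M • (w, 1)` one of `(0, 1)` and the `(v i, 1)`, so every element has a representation with `m < M`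
and `j < N` (`sumset_subset_image`). Lower bound: the representations with `m = 0` and `j < N` are
pairwise distinct, since two of them agreeing would put a multiple of `(0, 1)` smaller than its order
into `Λ` (`injOn_evalRep`). In both cases the representations are counted by stars and bars and the
hockey-stick identity (`card_boxReps_eq_piecewiseSum`). The least `M` is at most `N` because `w` lies
in the simplex, so its barycentric coordinates are nonnegative and become integers after
multiplication by `N` (`latticeIndex_nsmul_lift_mem_coneZero`). The exact formulas are the cases in
which the two bounds coincide.
-/

namespace SimplexSumset

/-! ### Counting representations -/

theorem card_piAntidiag_fin (d s : ℕ) :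
    (Finset.piAntidiag (Finset.univ : Finset (Fin (d + 1))) s).card = (s + d).choose s := by
  have e := Nat.card_congr (Sym.equivNatSumOfFintype (Fin (d + 1)) s)
  have h : Nat.card {P : Fin (d + 1) → ℕ // ∑ i, P i = s} =
      (Finset.piAntidiag (Finset.univ : Finset (Fin (d + 1))) s).card :=
    Nat.subtype_card _ (by simp)
  rw [← h, ← e, Nat.card_eq_fintype_card, Sym.card_sym_eq_multichoose, Nat.multichoose_eq,
    Fintype.card_fin]
  congr 1
  lia

theorem sum_range_choose_diag (d h : ℕ) :
    ∑ j ∈ Finset.range (h + 1), ((h - j + d).choose (h - j) : ℤ) = ((h + d + 1).choose h : ℤ) := by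
  have h1 := Finset.sum_range_reflect (fun i => ((i + d).choose i : ℤ)) (h + 1)
  have h2 := Nat.sum_range_add_choose h d
  have h3 : ∀ i, (i + d).choose i = (i + d).choose d := fun i => Nat.choose_symm_add
  have h4 : (h + d + 1).choose h = (h + d + 1).choose (d + 1) := by
    rw [add_assoc]; exact Nat.choose_symm_add
  rw [h4, ← h2]
  simp only [Nat.add_one_sub_one] at h1
  push_cast
  simp only [h3] at h1 ⊢
  exact h1

theorem sum_range_choose_diag_truncated (d L h : ℕ) :
    ∑ j ∈ Finset.range L, (if j ≤ h then ((h - j + d).choose (h - j) : ℤ) else 0) =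
      ((h + d + 1).choose h : ℤ) -
        (if L ≤ h then ((h - L + d + 1).choose (h - L) : ℤ) else 0) := by
  rw [← sum_range_choose_diag d h]
  split_ifs with hL
  · rw [← sum_range_choose_diag d (h - L)]
    have h1 : h + 1 = L + (h - L + 1) := by lia
    rw [h1, Finset.sum_range_add, eq_sub_iff_add_eq]
    congr 1
    · refine Finset.sum_congr rfl fun j hj => ?_
      rw [if_pos]
      have := Finset.mem_range.1 hj
      lia
    · refine Finset.sum_congr rfl fun j hj => ?_
      rw [Nat.sub_sub]
  · rw [sub_zero, ← Finset.sum_filter]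
    refine Finset.sum_congr ?_ fun _ _ => rfl
    ext j
    simp only [Finset.mem_filter, Finset.mem_range]
    lia

/-- The triples `(m, j, k)` of multiplicities of `w`, of `0` and of the vertices with `m < K`,
`j < L` and total multiplicity `h`. The vertex multiplicities `k` form a dependent component, since
their sum is prescribed by `m` and `j`. -/
def boxReps (d L K h : ℕ) : Finset ((_ : ℕ × ℕ) × (Fin (d + 1) → ℕ)) :=
  (((Finset.range K) ×ˢ (Finset.range L)).filter fun p => p.1 + p.2 ≤ h).sigma fun p =>
    Finset.piAntidiag Finset.univ (h - p.1 - p.2)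

theorem mem_boxReps {d L K h m j : ℕ} {k : Fin (d + 1) → ℕ} :
    (⟨(m, j), k⟩ : (_ : ℕ × ℕ) × (Fin (d + 1) → ℕ)) ∈ boxReps d L K h ↔
      m < K ∧ j < L ∧ ∑ i, k i + j + m = h := by
  simp only [boxReps, Finset.mem_sigma, Finset.mem_filter, Finset.mem_product, Finset.mem_range,
    Finset.mem_piAntidiag, Finset.mem_univ, implies_true, and_true]
  lia

theorem card_boxReps (d L K h : ℕ) :
    ((boxReps d L K h).card : ℤ) = ∑ m ∈ Finset.range K, if m ≤ h then
      ((h - m + d + 1).choose (h - m) : ℤ) -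
        (if L + m ≤ h then ((h - m - L + d + 1).choose (h - m - L) : ℤ) else 0) else 0 := by
  rw [boxReps, Finset.card_sigma]
  simp only [card_piAntidiag_fin]
  push_cast
  rw [Finset.sum_filter, Finset.sum_product]
  refine Finset.sum_congr rfl fun m _ => ?_
  split_ifs with h1 h2
  · have := sum_range_choose_diag_truncated d L (h - m)
    rw [if_pos (by lia)] at this
    rw [← this]
    refine Finset.sum_congr rfl fun j _ => ?_
    exact if_congr (by lia) rfl rfl
  · have := sum_range_choose_diag_truncated d L (h - m)
    rw [if_neg (by lia)] at this
    rw [← this]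
    refine Finset.sum_congr rfl fun j _ => ?_
    exact if_congr (by lia) rfl rfl
  · exact Finset.sum_eq_zero fun j _ => if_neg (by lia)

theorem card_boxReps_eq_piecewiseSum {d L K : ℕ} (hKL : K ≤ L) (h : ℕ) :
    ((boxReps d L K h).card : ℤ) = piecewiseSum d L K h := by
  have hreflect : ∀ n K' : ℕ, n < K' →
      ∑ m ∈ Finset.range K', (if m ≤ n then ((n - m + d + 1).choose (n - m) : ℤ) else 0) =
        ∑ m ∈ Finset.range (n + 1), ((m + d + 1).choose m : ℤ) := by
    intro n K' hn
    rw [← Finset.sum_range_reflect (fun m => ((m + d + 1).choose m : ℤ)), ← Finset.sum_filter]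
    refine Finset.sum_congr ?_ fun m hm => ?_
    · ext m
      simp only [Finset.mem_filter, Finset.mem_range]
      lia
    · rw [show n + 1 - 1 - m = n - m by lia]
  have hsplit : ((boxReps d L K h).card : ℤ) =
      ∑ m ∈ Finset.range K, (if m ≤ h then ((h - m + d + 1).choose (h - m) : ℤ) else 0) -
      ∑ m ∈ Finset.range K,
        (if L + m ≤ h then ((h - m - L + d + 1).choose (h - m - L) : ℤ) else 0) := by
    rw [card_boxReps, ← Finset.sum_sub_distrib]
    refine Finset.sum_congr rfl fun m _ => ?_
    split_ifs <;> first | rfl | lia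
  have hfirst : K ≤ h →
      ∑ m ∈ Finset.range K, (if m ≤ h then ((h - m + d + 1).choose (h - m) : ℤ) else 0) =
        ∑ m ∈ Finset.range K, ((h + d + 1 - m).choose (h - m) : ℤ) := by
    intro hK
    refine Finset.sum_congr rfl fun m hm => ?_
    have := Finset.mem_range.1 hm
    rw [if_pos (by lia), show h - m + d + 1 = h + d + 1 - m by lia]
  have hzero : h < L → ∑ m ∈ Finset.range K,
      (if L + m ≤ h then ((h - m - L + d + 1).choose (h - m - L) : ℤ) else 0) = 0 := fun hL =>
    Finset.sum_eq_zero fun m _ => if_neg (by lia)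
  rw [hsplit, piecewiseSum]
  split_ifs with h1 h2 h3
  · rw [hzero (by lia), sub_zero, hreflect h K h1]
  · rw [hzero h2, sub_zero, hfirst (by lia)]
  · rw [hfirst (by lia), ← hreflect (h - L) K (by lia)]
    congr 1
    refine Finset.sum_congr rfl fun m _ => ?_
    rw [show h - m - L = h - L - m by lia]
    exact if_congr (by lia) rfl rfl
  · rw [hfirst (by lia)]
    congr 1
    refine Finset.sum_congr rfl fun m hm => ?_
    have := Finset.mem_range.1 hm
    rw [if_pos (by lia), show h - m - L + d + 1 = h + d + 1 - m - L by lia]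


/-! ### Sumsets as slices of a monoid -/

theorem sumset_add_mem {d : ℕ} {A : Set (Fin d → ℤ)} {h h' : ℕ} {x y : Fin d → ℤ}
    (hx : x ∈ sumset h A) (hy : y ∈ sumset h' A) : x + y ∈ sumset (h + h') A := by
  obtain ⟨f, hf, rfl⟩ := hx
  obtain ⟨g, hg, rfl⟩ := hy
  refine ⟨Fin.append f g, fun i => ?_, by simp [Fin.sum_univ_add]⟩
  refine Fin.addCases (fun i => ?_) (fun i => ?_) i
  · simpa using hf i
  · simpa using hg i

/-- The sumset `hA` is the slice at height `h` of the monoid generated by the lift of `A`. -/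
theorem mem_sumset_iff_mem_closure {d : ℕ} {A : Set (Fin d → ℤ)} {h : ℕ} {x : Fin d → ℤ} :
    x ∈ sumset h A ↔ (x, (h : ℤ)) ∈ AddSubmonoid.closure (lift '' A) := by
  constructor
  · rintro ⟨f, hf, rfl⟩
    have h1 : ((∑ i, f i, (h : ℤ)) : (Fin d → ℤ) × ℤ) = ∑ i, lift (f i) := by
      ext1 <;> simp [Prod.fst_sum, Prod.snd_sum, lift]
    rw [h1]
    exact sum_mem fun i _ => AddSubmonoid.subset_closure ⟨f i, hf i, rfl⟩
  · intro hx
    have key : ∀ p ∈ AddSubmonoid.closure (lift '' A), ∃ n : ℕ, p.2 = n ∧ p.1 ∈ sumset n A := by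
      intro p hp
      induction hp using AddSubmonoid.closure_induction with
      | mem p hp =>
        obtain ⟨y, hy, rfl⟩ := hp
        exact ⟨1, by simp [lift], fun _ => y, fun _ => hy, by simp [lift]⟩
      | zero => exact ⟨0, by simp, Fin.elim0, fun i => i.elim0, by simp⟩
      | add p p' _ _ hp hp' =>
        obtain ⟨n, hn, hpn⟩ := hp
        obtain ⟨n', hn', hpn'⟩ := hp'
        exact ⟨n + n', by simp [hn, hn'], sumset_add_mem hpn hpn'⟩
    obtain ⟨n, hn, hxn⟩ := key _ hx
    obtain rfl : h = n := Int.ofNat_inj.1 hn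
    exact hxn

theorem mem_coneZero_iff {d : ℕ} {v : Fin (d + 1) → (Fin d → ℤ)} {p : (Fin d → ℤ) × ℤ} :
    p ∈ coneZero v ↔ ∃ (j : ℕ) (k : Fin (d + 1) → ℕ),
      j • lift 0 + ∑ i, k i • lift (v i) = p := by
  rw [coneZero, Set.insert_eq, AddSubmonoid.closure_union, AddSubmonoid.mem_sup]
  simp only [AddSubmonoid.mem_closure_singleton, AddSubmonoid.mem_closure_range_iff_of_fintype]
  constructor
  · rintro ⟨_, ⟨j, rfl⟩, _, ⟨k, rfl⟩, rfl⟩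
    exact ⟨j, k, rfl⟩
  · rintro ⟨j, k, rfl⟩
    exact ⟨_, ⟨j, rfl⟩, _, ⟨k, rfl⟩, rfl⟩

theorem mem_sumset_iff {d : ℕ} {v : Fin (d + 1) → (Fin d → ℤ)} {w x : Fin d → ℤ} {h : ℕ} :
    x ∈ sumset h (insert 0 (insert w (Set.range v))) ↔
      ∃ (m j : ℕ) (k : Fin (d + 1) → ℕ),
        m • lift w + (j • lift 0 + ∑ i, k i • lift (v i)) = (x, (h : ℤ)) := by
  have hset : lift '' (insert 0 (insert w (Set.range v))) =
      {lift w} ∪ insert (lift 0) (Set.range fun i => lift (v i)) := by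
    rw [Set.image_insert_eq, Set.image_insert_eq, ← Set.range_comp, Set.singleton_union,
      Set.insert_comm]
    rfl
  rw [mem_sumset_iff_mem_closure, hset, AddSubmonoid.closure_union, AddSubmonoid.mem_sup]
  change (∃ y ∈ _, ∃ z ∈ coneZero v, _) ↔ _
  simp only [AddSubmonoid.mem_closure_singleton, mem_coneZero_iff]
  constructor
  · rintro ⟨_, ⟨m, rfl⟩, _, ⟨j, k, rfl⟩, h⟩
    exact ⟨m, j, k, h⟩
  · rintro ⟨m, j, k, h⟩
    exact ⟨_, ⟨m, rfl⟩, _, ⟨j, k, rfl⟩, h⟩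

/-! ### Coordinates with respect to the vertices -/

theorem sum_zsmul_lift_eq_iff {d : ℕ} {v : Fin (d + 1) → (Fin d → ℤ)} {c : Fin (d + 1) → ℤ}
    {p : (Fin d → ℤ) × ℤ} :
    ∑ i, c i • lift (v i) = p ↔ (∀ j, ∑ i, c i * v i j = p.1 j) ∧ ∑ i, c i = p.2 := by
  simp [Prod.ext_iff, Prod.fst_sum, Prod.snd_sum, lift, funext_iff]

theorem coeff_eq_zero {d : ℕ} {v : Fin (d + 1) → (Fin d → ℤ)}
    (hv : AffineIndependent ℝ fun i => toReal (v i)) {c : Fin (d + 1) → ℝ}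
    (hsum : ∑ i, c i = 0) (hcomb : ∀ j, ∑ i, c i * (v i j : ℝ) = 0) (i : Fin (d + 1)) :
    c i = 0 := by
  refine hv.eq_zero_of_sum_eq_zero hsum ?_ i (Finset.mem_univ i)
  ext j
  simpa [toReal] using hcomb j

theorem coeff_eq_of_sum_eq {d : ℕ} {v : Fin (d + 1) → (Fin d → ℤ)}
    (hv : AffineIndependent ℝ fun i => toReal (v i)) {n : ℕ} {x : Fin d → ℤ}
    {c : Fin (d + 1) → ℤ} (hc : ∑ i, c i • lift (v i) = n • lift x)
    {t : Fin (d + 1) → ℝ} (ht : ∑ i, t i = 1) (htx : ∀ j, ∑ i, t i * (v i j : ℝ) = x j)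
    (i : Fin (d + 1)) : (c i : ℝ) = n * t i := by
  obtain ⟨h1, h2⟩ := sum_zsmul_lift_eq_iff.1 hc
  rw [← sub_eq_zero]
  refine coeff_eq_zero hv (c := fun i => (c i : ℝ) - n * t i) ?_ (fun j => ?_) i
  · rw [Finset.sum_sub_distrib, ← Finset.mul_sum, ht, ← Int.cast_sum, h2]
    simp [lift]
  · simp only [sub_mul, mul_assoc]
    rw [Finset.sum_sub_distrib, ← Finset.mul_sum, htx]
    have := congrArg (Int.cast : ℤ → ℝ) (h1 j)
    push_cast at this
    rw [this]
    simp [lift]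

/-- If every `q i` divides `n`, the barycentric coordinates of `0` yield a relation with
nonnegative integer coefficients for `n • (0, 1)`. -/
theorem sum_div_smul_lift {d : ℕ} {v : Fin (d + 1) → (Fin d → ℤ)} {a q : Fin (d + 1) → ℕ}
    (hq : ∀ i, 0 < q i) (hsum : ∑ i, (a i : ℚ) / (q i : ℚ) = 1)
    (hzero : ∀ j, ∑ i, (a i : ℚ) / (q i : ℚ) * (v i j : ℚ) = 0) {n : ℕ} (hn : ∀ i, q i ∣ n) :
    ∑ i, (n / q i * a i) • lift (v i) = n • lift 0 := by
  have hcast : ∀ i, ((n / q i * a i : ℕ) : ℚ) = n * ((a i : ℚ) / q i) := by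
    intro i
    have : (q i : ℚ) ≠ 0 := by exact_mod_cast (hq i).ne'
    rw [Nat.cast_mul, Nat.cast_div (hn i) this]
    ring
  have key : ∑ i, ((n / q i * a i : ℕ) : ℤ) • lift (v i) = n • lift 0 := by
    rw [sum_zsmul_lift_eq_iff]
    constructor
    · intro j
      have h : ∑ i, ((n / q i * a i : ℕ) : ℚ) * (v i j : ℚ) = 0 := by
        simp only [hcast, mul_assoc]
        rw [← Finset.mul_sum, hzero, mul_zero]
      have h' : ∑ i, ((n / q i * a i : ℕ) : ℤ) * v i j = 0 := by
        have hc : ((∑ i, ((n / q i * a i : ℕ) : ℤ) * v i j : ℤ) : ℚ) = 0 := by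
          simpa only [Int.cast_sum, Int.cast_mul, Int.cast_natCast] using h
        exact Int.cast_eq_zero.1 hc
      rw [h']
      simp [lift]
    · have h : ∑ i, ((n / q i * a i : ℕ) : ℚ) = n := by
        simp only [hcast]
        rw [← Finset.mul_sum, hsum, mul_one]
      have h' : ∑ i, ((n / q i * a i : ℕ) : ℤ) = n := by exact_mod_cast h
      rw [h']
      simp [lift]
  simpa only [natCast_zsmul] using key

theorem nsmul_lift_zero_mem_lattice_iff {d : ℕ} {v : Fin (d + 1) → (Fin d → ℤ)}
    (hv : AffineIndependent ℝ fun i => toReal (v i)) {a q : Fin (d + 1) → ℕ}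
    (hq : ∀ i, 0 < q i) (hcop : ∀ i, Nat.Coprime (a i) (q i))
    (hsum : ∑ i, (a i : ℚ) / (q i : ℚ) = 1)
    (hzero : ∀ j, ∑ i, (a i : ℚ) / (q i : ℚ) * (v i j : ℚ) = 0) {n : ℕ} :
    n • lift 0 ∈ lattice v ↔ Finset.univ.lcm q ∣ n := by
  simp only [Finset.lcm_dvd_iff, Finset.mem_univ, true_implies]
  constructor
  · intro h i
    obtain ⟨c, hc⟩ := AddSubgroup.mem_closure_range_iff_of_fintype.1 h
    have ht : ∑ i, (a i : ℝ) / (q i : ℝ) = 1 := by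
      simpa using congrArg (Rat.cast : ℚ → ℝ) hsum
    have htx : ∀ j, ∑ i, (a i : ℝ) / (q i : ℝ) * (v i j : ℝ) = ((0 : Fin d → ℤ) j : ℝ) := by
      intro j
      have := congrArg (Rat.cast : ℚ → ℝ) (hzero j)
      push_cast at this
      simpa using this
    have h1 := coeff_eq_of_sum_eq hv hc.symm ht htx i
    have hqi : (q i : ℝ) ≠ 0 := by exact_mod_cast (hq i).ne'
    have h2 : c i * q i = n * a i := by
      rify
      rw [h1]
      field_simp
    have h3 : q i ∣ n * a i := by
      have : (q i : ℤ) ∣ n * a i := ⟨c i, by rw [← h2, mul_comm]⟩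
      exact_mod_cast this
    exact (hcop i).symm.dvd_of_dvd_mul_right h3
  · intro h
    rw [← sum_div_smul_lift hq hsum hzero h]
    exact sum_mem fun i _ => nsmul_mem (AddSubgroup.subset_closure (Set.mem_range_self i)) _

/-! ### The two lattice indices -/

theorem latticeZero_eq_top {d : ℕ} {v : Fin (d + 1) → (Fin d → ℤ)}
    (hgen : AddSubgroup.closure (Set.range v) = ⊤) : latticeZero v = ⊤ := by
  have hz : lift 0 ∈ latticeZero v := AddSubgroup.subset_closure (Set.mem_insert _ _)
  have hx : ∀ x : Fin d → ℤ, (x, 0) ∈ latticeZero v := by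
    intro x
    have hx : x ∈ AddSubgroup.closure (Set.range v) := hgen ▸ AddSubgroup.mem_top x
    induction hx using AddSubgroup.closure_induction with
    | mem x hx =>
      obtain ⟨i, rfl⟩ := hx
      have hi : lift (v i) ∈ latticeZero v :=
        AddSubgroup.subset_closure (Set.mem_insert_of_mem _ (Set.mem_range_self i))
      simpa [lift] using sub_mem hi hz
    | zero => exact zero_mem _
    | add x y _ _ hx hy => simpa using add_mem hx hy
    | neg x _ hx => simpa using neg_mem hx
  rw [AddSubgroup.eq_top_iff']
  rintro ⟨x, s⟩
  simpa [lift] using add_mem (hx x) (zsmul_mem hz s)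

/-- The quotient of `Λ_{(0,1)}` by `Λ` is cyclic, generated by the class of `(0, 1)`; when
`Λ_{(0,1)}` is everything, the index of `Λ` is the order of that class. -/
theorem latticeIndex_eq_lcm {d : ℕ} {v : Fin (d + 1) → (Fin d → ℤ)}
    (hv : AffineIndependent ℝ fun i => toReal (v i)) (htop : latticeZero v = ⊤)
    {a q : Fin (d + 1) → ℕ}
    (hq : ∀ i, 0 < q i) (hcop : ∀ i, Nat.Coprime (a i) (q i))
    (hsum : ∑ i, (a i : ℚ) / (q i : ℚ) = 1)
    (hzero : ∀ j, ∑ i, (a i : ℚ) / (q i : ℚ) * (v i j : ℚ) = 0) :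
    latticeIndex v = Finset.univ.lcm q := by
  let π := QuotientAddGroup.mk' (lattice v)
  have hgen : AddSubgroup.zmultiples (π (lift 0)) = ⊤ := by
    have hle : latticeZero v ≤ (AddSubgroup.zmultiples (π (lift 0))).comap π := by
      refine (AddSubgroup.closure_le _).2 ?_
      rintro _ (rfl | ⟨i, rfl⟩)
      · exact AddSubgroup.mem_zmultiples _
      · have : π (lift (v i)) = 0 :=
          (QuotientAddGroup.eq_zero_iff _).2 (AddSubgroup.subset_closure (Set.mem_range_self i))
        simp [this]
    rw [AddSubgroup.eq_top_iff']
    intro y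
    obtain ⟨x, rfl⟩ := QuotientAddGroup.mk'_surjective (lattice v) y
    exact hle (htop ▸ AddSubgroup.mem_top x)
  have hindex : latticeIndex v = addOrderOf (π (lift 0)) := by
    rw [← Nat.card_zmultiples, hgen, latticeIndex, AddSubgroup.index_eq_card]
    exact AddSubgroup.card_top.symm
  rw [hindex]
  refine Nat.dvd_right_iff_eq.1 fun n => ?_
  rw [addOrderOf_dvd_iff_nsmul_eq_zero, ← map_nsmul,
    ← nsmul_lift_zero_mem_lattice_iff hv hq hcop hsum hzero]
  exact QuotientAddGroup.eq_zero_iff _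

/-- A point of the simplex with vertices `v` has nonnegative coordinates, and multiplying by the
index of `Λ` makes them integral. -/
theorem latticeIndex_nsmul_lift_mem_coneZero {d : ℕ} {v : Fin (d + 1) → (Fin d → ℤ)}
    (hv : AffineIndependent ℝ fun i => toReal (v i)) {w : Fin d → ℤ}
    (hw : toReal w ∈ hull (Set.range v)) : latticeIndex v • lift w ∈ coneZero v := by
  classical
  rw [hull, ← Set.range_comp, convexHull_range_eq_exists_affineCombination] at hw
  obtain ⟨s, t, ht0, ht1, htw⟩ := hw
  rw [Finset.affineCombination_eq_linear_combination _ _ _ ht1] at htw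
  have ht : ∑ i, (if i ∈ s then t i else 0) = 1 := by simpa using ht1
  have htx : ∀ j, ∑ i, (if i ∈ s then t i else 0) * (v i j : ℝ) = w j := by
    intro j
    have := congrFun htw j
    simpa [toReal, ite_mul] using this
  have hmem : latticeIndex v • lift w ∈ lattice v := (lattice v).nsmul_index_mem (lift w)
  obtain ⟨c, hc⟩ := AddSubgroup.mem_closure_range_iff_of_fintype.1 hmem
  have hnonneg : ∀ i, 0 ≤ c i := by
    intro i
    have h := coeff_eq_of_sum_eq hv hc.symm ht htx i
    have h0 : (0 : ℝ) ≤ c i := by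
      rw [h]
      refine mul_nonneg (Nat.cast_nonneg _) ?_
      split_ifs with hi
      exacts [ht0 i hi, le_rfl]
    exact_mod_cast h0
  lift c to Fin (d + 1) → ℕ using hnonneg
  refine mem_coneZero_iff.2 ⟨0, c, ?_⟩
  rw [hc]
  simp


/-! ### Normal forms of the elements of the sumset -/

/-- The element of `ℤ^d` with multiplicities `p` of `w`, of `0` and of the vertices. -/
def evalRep {d : ℕ} (v : Fin (d + 1) → (Fin d → ℤ)) (w : Fin d → ℤ)
    (p : (_ : ℕ × ℕ) × (Fin (d + 1) → ℕ)) : Fin d → ℤ :=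
  p.1.1 • w + ∑ i, p.2 i • v i

theorem lift_combination_eq_iff {d : ℕ} {v : Fin (d + 1) → (Fin d → ℤ)} {w x : Fin d → ℤ}
    {m j h : ℕ} {k : Fin (d + 1) → ℕ} :
    m • lift w + (j • lift 0 + ∑ i, k i • lift (v i)) = (x, (h : ℤ)) ↔
      evalRep v w ⟨(m, j), k⟩ = x ∧ ∑ i, k i + j + m = h := by
  rw [Prod.ext_iff]
  refine and_congr ?_ ?_
  · simp [lift, evalRep, Prod.fst_sum]
  · rw [← @Nat.cast_inj ℤ]
    simp only [lift, Prod.snd_add, Prod.snd_sum, Prod.smul_snd, nsmul_one]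
    push_cast
    rw [show (m : ℤ) + (j + ∑ i, (k i : ℤ)) = ∑ i, (k i : ℤ) + j + m by ring]

/-- Relations expressing `M • (w, 1)` and `L • (0, 1)` with nonnegative coefficients allow the
multiplicity of `w` to be reduced modulo `M`, and then that of `0` modulo `L`. -/
theorem sumset_subset_image {d : ℕ} {v : Fin (d + 1) → (Fin d → ℤ)} {w : Fin d → ℤ}
    {L M : ℕ} (hL : 0 < L) (hM : 0 < M) {b : Fin (d + 1) → ℕ}
    (hb : ∑ i, b i • lift (v i) = L • lift 0) (hMw : M • lift w ∈ coneZero v) (h : ℕ) :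
    sumset h (insert 0 (insert w (Set.range v))) ⊆ evalRep v w '' (boxReps d L M h) := by
  intro x hx
  obtain ⟨m, j, k, hx⟩ := mem_sumset_iff.1 hx
  obtain ⟨j₀, k₀, hw⟩ := mem_coneZero_iff.1 hMw
  -- Reducing `m` modulo `M` changes the multiplicity of `0` to `j₁`, which is reduced next.
  set j₁ := j + m / M * j₀ with hj₁
  set k₁ : Fin (d + 1) → ℕ := fun i => k i + m / M * k₀ i + j₁ / L * b i with hk₁
  have hm : m • lift w = (m % M) • lift w + (m / M) • (j₀ • lift 0 + ∑ i, k₀ i • lift (v i)) := by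
    conv_lhs => rw [← Nat.mod_add_div m M]
    rw [add_nsmul, mul_comm, mul_nsmul', hw]
  have hj : j₁ • lift (0 : Fin d → ℤ) = (j₁ % L) • lift 0 + (j₁ / L) • ∑ i, b i • lift (v i) := by
    conv_lhs => rw [← Nat.mod_add_div j₁ L]
    rw [add_nsmul, mul_comm, mul_nsmul', hb]
  have hk : ∑ i, k₁ i • lift (v i) = ∑ i, k i • lift (v i) +
      (m / M) • ∑ i, k₀ i • lift (v i) + (j₁ / L) • ∑ i, b i • lift (v i) := by
    simp only [hk₁, add_nsmul, Finset.sum_add_distrib, mul_nsmul', Finset.smul_sum]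
  have hx' : (m % M) • lift w + ((j₁ % L) • lift 0 + ∑ i, k₁ i • lift (v i)) = (x, (h : ℤ)) := by
    rw [← hx, hm, hk, nsmul_add, ← mul_nsmul', ← sub_eq_zero]
    have hj' : j • lift (0 : Fin d → ℤ) + (m / M * j₀) • lift 0 =
        (j₁ % L) • lift 0 + (j₁ / L) • ∑ i, b i • lift (v i) := by
      rw [← add_nsmul, ← hj]
    have hj'' := eq_sub_of_add_eq hj'
    rw [hj'']
    abel
  obtain ⟨h1, h2⟩ := lift_combination_eq_iff.1 hx'
  exact ⟨⟨(m % M, j₁ % L), k₁⟩,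
    mem_boxReps.2 ⟨Nat.mod_lt _ hM, Nat.mod_lt _ hL, h2⟩, h1⟩

theorem image_boxReps_subset_sumset {d : ℕ} (v : Fin (d + 1) → (Fin d → ℤ)) (w : Fin d → ℤ)
    (L K h : ℕ) :
    evalRep v w '' (boxReps d L K h) ⊆ sumset h (insert 0 (insert w (Set.range v))) := by
  rintro _ ⟨⟨⟨m, j⟩, k⟩, hp, rfl⟩
  exact mem_sumset_iff.2 ⟨m, j, k, lift_combination_eq_iff.2 ⟨rfl, (mem_boxReps.1 hp).2.2⟩⟩

/-- Two representations without `w` of the same element at the same height differ by a relation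
for a multiple of `(0, 1)`; below its order modulo `Λ` there is none. -/
theorem injOn_evalRep {d : ℕ} {v : Fin (d + 1) → (Fin d → ℤ)} (w : Fin d → ℤ)
    (hv : AffineIndependent ℝ fun i => toReal (v i)) {L : ℕ}
    (hL : ∀ n : ℕ, n • lift 0 ∈ lattice v → L ∣ n) (h : ℕ) :
    Set.InjOn (evalRep v w) (boxReps d L 1 h) := by
  have hspan : ∀ k : Fin (d + 1) → ℕ, ∑ i, k i • lift (v i) ∈ lattice v := fun k =>
    sum_mem fun i _ => nsmul_mem (AddSubgroup.subset_closure (Set.mem_range_self i)) _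
  have hle : ∀ (j j' : ℕ) (k k' : Fin (d + 1) → ℕ), j < L → j' ≤ j →
      j • lift 0 + ∑ i, k i • lift (v i) = j' • lift 0 + ∑ i, k' i • lift (v i) → j = j' := by
    intro j j' k k' hj hjj' heq
    have hmem : (j - j') • lift 0 ∈ lattice v := by
      have hsub : (j - j') • lift (0 : Fin d → ℤ) =
          ∑ i, k' i • lift (v i) - ∑ i, k i • lift (v i) := by
        rw [eq_sub_iff_add_eq, ← add_right_inj (j' • lift (0 : Fin d → ℤ)), ← heq, ← add_assoc,
          ← add_nsmul, Nat.add_sub_cancel' hjj']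
      rw [hsub]
      exact sub_mem (hspan k') (hspan k)
    have := Nat.eq_zero_of_dvd_of_lt (hL _ hmem) (by lia)
    lia
  rintro ⟨⟨m, j⟩, k⟩ hp ⟨⟨m', j'⟩, k'⟩ hp' heq
  obtain ⟨hm, hj, hs⟩ := mem_boxReps.1 hp
  obtain ⟨hm', hj', hs'⟩ := mem_boxReps.1 hp'
  obtain rfl : m = 0 := by lia
  obtain rfl : m' = 0 := by lia
  have e := lift_combination_eq_iff.2 ⟨heq, hs⟩
  rw [← lift_combination_eq_iff.2 ⟨rfl, hs'⟩, zero_nsmul, zero_add, zero_add] at e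
  obtain rfl : j = j' := by
    rcases le_total j' j with hjj | hjj
    · exact hle j j' k k' hj hjj e
    · exact (hle j' j k' k hj' hjj e.symm).symm
  have hk : k = k' := by
    have hz : ∑ i, ((k i : ℤ) - k' i) • lift (v i) = 0 := by
      simp only [sub_smul, natCast_zsmul, Finset.sum_sub_distrib]
      exact sub_eq_zero.2 (add_left_cancel e)
    obtain ⟨h1, h2⟩ := sum_zsmul_lift_eq_iff.1 hz
    funext i
    have h3 := coeff_eq_zero hv (c := fun i => (k i : ℝ) - k' i) (by exact_mod_cast h2)
      (fun j => by exact_mod_cast h1 j) i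
    exact_mod_cast sub_eq_zero.1 h3
  rw [hk]

end SimplexSumset

/-! ### The size of the sumset -/

theorem theorem1p3 (d : ℕ) (v : Fin (d + 1) → (Fin d → ℤ)) (w : Fin d → ℤ)
    (A : Set (Fin d → ℤ)) (hA : A = insert 0 (insert w (Set.range v)))
    (hcard : A.ncard = d + 3)
    (hsimplex : SimplexSumset.HullIsSimplex A v)
    (hgen : AddSubgroup.closure (Set.range v) = ⊤)
    (a q : Fin (d + 1) → ℕ) (hq : ∀ i, 0 < q i) (hcop : ∀ i, Nat.Coprime (a i) (q i))
    (hsum : ∑ i, (a i : ℚ) / (q i : ℚ) = 1)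
    (hzero : ∀ j, ∑ i, (a i : ℚ) / (q i : ℚ) * (v i j : ℚ) = 0) :
    SimplexSumset.latticeZeroIndex v * Finset.univ.lcm q = SimplexSumset.latticeIndex v ∧
    (SimplexSumset.latticeZeroIndex v • SimplexSumset.lift w ∈ SimplexSumset.coneZero v →
      ∀ h : ℕ, ((SimplexSumset.sumset h A).ncard : ℤ) =
        SimplexSumset.piecewiseSum d (SimplexSumset.latticeIndex v)
          (SimplexSumset.latticeZeroIndex v) h) ∧
    (∃ M : ℕ,
      IsLeast {M : ℕ | 0 < M ∧ (M * SimplexSumset.latticeZeroIndex v) • SimplexSumset.lift w ∈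
        SimplexSumset.coneZero v} M ∧
      M * SimplexSumset.latticeZeroIndex v ≤ SimplexSumset.latticeIndex v ∧
      ∀ h : ℕ, ((SimplexSumset.sumset h A).ncard : ℤ) ≤
        SimplexSumset.piecewiseSum d (SimplexSumset.latticeIndex v)
          (M * SimplexSumset.latticeZeroIndex v) h) ∧
    (∀ h : ℕ, SimplexSumset.piecewiseSum d (SimplexSumset.latticeIndex v)
        (SimplexSumset.latticeZeroIndex v) h ≤ ((SimplexSumset.sumset h A).ncard : ℤ)) ∧
    (∀ h : ℕ, h + 1 ≤ SimplexSumset.latticeZeroIndex v →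
      ((SimplexSumset.sumset h A).ncard : ℤ) =
        ∑ m ∈ Finset.range (h + 1), ((m + d + 1).choose m : ℤ)) := by
  obtain ⟨hv, hhull⟩ := hsimplex
  have htop := SimplexSumset.latticeZero_eq_top hgen
  have hN₀ : SimplexSumset.latticeZeroIndex v = 1 := by
    rw [SimplexSumset.latticeZeroIndex, htop, AddSubgroup.index_top]
  have hN : SimplexSumset.latticeIndex v = Finset.univ.lcm q :=
    SimplexSumset.latticeIndex_eq_lcm hv htop hq hcop hsum hzero
  have hNpos : 0 < SimplexSumset.latticeIndex v := by
    rw [hN, Nat.pos_iff_ne_zero, Ne, Finset.lcm_eq_zero_iff]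
    simpa using fun i => (hq i).ne'
  have hwN : SimplexSumset.latticeIndex v • SimplexSumset.lift w ∈ SimplexSumset.coneZero v := by
    refine SimplexSumset.latticeIndex_nsmul_lift_mem_coneZero hv ?_
    rw [← hhull, hA]
    exact subset_convexHull _ _ ⟨w, by simp, rfl⟩
  have hrel : ∑ i, (SimplexSumset.latticeIndex v / q i * a i) • SimplexSumset.lift (v i) =
      SimplexSumset.latticeIndex v • SimplexSumset.lift 0 :=
    SimplexSumset.sum_div_smul_lift hq hsum hzero fun i => hN ▸ Finset.dvd_lcm (Finset.mem_univ i)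
  have hord : ∀ n : ℕ, n • SimplexSumset.lift 0 ∈ SimplexSumset.lattice v →
      SimplexSumset.latticeIndex v ∣ n := fun n hn =>
    hN ▸ (SimplexSumset.nsmul_lift_zero_mem_lattice_iff hv hq hcop hsum hzero).1 hn
  have hupper : ∀ M : ℕ, 0 < M → M ≤ SimplexSumset.latticeIndex v →
      M • SimplexSumset.lift w ∈ SimplexSumset.coneZero v → ∀ h : ℕ,
      (SimplexSumset.sumset h A).Finite ∧ ((SimplexSumset.sumset h A).ncard : ℤ) ≤
        SimplexSumset.piecewiseSum d (SimplexSumset.latticeIndex v) M h := by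
    intro M hM hMN hMw h
    have hsub := SimplexSumset.sumset_subset_image hNpos hM hrel hMw h
    rw [← hA] at hsub
    have hfin := (SimplexSumset.boxReps d (SimplexSumset.latticeIndex v) M h).finite_toSet
    refine ⟨(hfin.image _).subset hsub, ?_⟩
    rw [← SimplexSumset.card_boxReps_eq_piecewiseSum hMN, Nat.cast_le, ← Set.ncard_coe_finset]
    exact (Set.ncard_le_ncard hsub (hfin.image _)).trans (Set.ncard_image_le hfin)
  have hlower : ∀ h : ℕ, SimplexSumset.piecewiseSum d (SimplexSumset.latticeIndex v) 1 h ≤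
      ((SimplexSumset.sumset h A).ncard : ℤ) := by
    intro h
    have hsub := SimplexSumset.image_boxReps_subset_sumset v w (SimplexSumset.latticeIndex v) 1 h
    rw [← hA] at hsub
    rw [← SimplexSumset.card_boxReps_eq_piecewiseSum hNpos, Nat.cast_le, ← Set.ncard_coe_finset,
      ← (SimplexSumset.injOn_evalRep w hv hord h).ncard_image]
    exact Set.ncard_le_ncard hsub (hupper _ hNpos le_rfl hwN h).1
  -- Parts 2 and 4 follow from the bounds: in part 2 the upper bound applies with `M = 1`, and in
  -- part 4 both bounds are given by the first branch of `piecewiseSum`.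
  rw [hN₀]
  simp only [mul_one, one_mul]
  classical
  have hex : ∃ M : ℕ, 0 < M ∧ M • SimplexSumset.lift w ∈ SimplexSumset.coneZero v :=
    ⟨_, hNpos, hwN⟩
  obtain ⟨M, hM⟩ : ∃ M, IsLeast {M : ℕ | 0 < M ∧ M • SimplexSumset.lift w ∈
      SimplexSumset.coneZero v} M := ⟨Nat.find hex, Nat.find_spec hex, fun _ h => Nat.find_min' hex h⟩
  have hMN : M ≤ SimplexSumset.latticeIndex v := hM.2 ⟨hNpos, hwN⟩
  have hupperM := fun h => (hupper M hM.1.1 hMN hM.1.2 h).2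
  refine ⟨hN.symm, fun hw h => ?_, ⟨M, hM, hMN, hupperM⟩, hlower, fun h hh => ?_⟩
  · exact le_antisymm (hupper 1 one_pos hNpos hw h).2 (hlower h)
  · have hle := hupperM h
    have hge := hlower h
    rw [SimplexSumset.piecewiseSum, if_pos (by have := hM.1.1; lia)] at hle
    rw [SimplexSumset.piecewiseSum, if_pos (by lia)] at hge
    exact le_antisymm hle hge
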